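/- Let $E_1,\dots,E_n,F$ be Banach spaces over $\mathbb K=\mathbb R$ or $\mathbb C$. For $1\le p<\infty$ and a finite sequence $x_1,\dots,x_m$ in a Banach space $E$ with dual $E'$ put $$\|(x_j)_{j=1}^m\|_{p}=\Big(\sum_{j=1}^m\|x_j\|^p\Big)^{1/p},\qquad \|(x_j)_{j=1}^m\|_{w,p}=\sup_{\varphi\in E',\ \|\varphi\|\le1}\Big(\sum_{j=1}^m|\varphi(x_j)|^p\Big)^{1/p},$$ and put $\|(x_j)_{j=1}^m\|_{\infty}=\|(x_j)_{j=1}^m\|_{w,\infty}=\sup_{j}\|x_j\|$. For $1\le p\le\infty$, a continuous $n$-linear map $T\colon E_1\times\cdots\times E_n\to F$ is called absolutely $p$-summing if there is $C\ge0$ such that $$\big\|\big(T(x^{(1)}_j,\dots,x^{(n)}_j)\big)_{j=1}^m\big\|_{p}\le C\prod_{i=1}^n\big\|(x^{(i)}_j)_{j=1}^m\big\|_{w,p}$$ for all $m\in\mathbb N$ and all $x^{(i)}_j\in E_i$, $1\le j\le m$, $1\le i\le n$. The class of these maps is denoted by $\mathcal L_{as,p}(E_1,\dots,E_n;F)$.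 A Banach space $E$ is called an $\mathcal L_\infty$-space if there is $\lambda>1$ such that every finite-dimensional subspace $G$ of $E$ is contained in a finite-dimensional subspace $H$ of $E$ for which there is an isomorphism $v\colon H\to\ell_\infty^{\dim H}$ with $\|v\|\,\|v^{-1}\|<\lambda$. **Theorem.** Let $1\le p\le r\le\infty$ and let $E_1,\dots,E_n$ all be $\mathcal L_\infty$-spaces. Then $$\mathcal L_{as,p}(E_1,\dots,E_n;F)\subseteq\mathcal L_{as,r}(E_1,\dots,E_n;F).$$ -/

import Mathlib

open scoped ENNReal

noncomputable section

/-- The norm of a finite sequence `(a₁, …, a_m)` in `l_p^m(E)`: it is `(∑ ‖a_j‖ ^ p) ^ (1 / p)` for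
`1 ≤ p < ∞` and `sup ‖a_j‖` for `p = ∞`. -/
def strongNorm {E : Type*} [NormedAddCommGroup E] (p : ℝ≥0∞) {m : ℕ} (a : Fin m → E) : ℝ :=
  ‖(WithLp.toLp p a : PiLp p (fun _ : Fin m => E))‖

/-- The norm of a finite sequence in `l_{p,w}^m(E)`: for `p < ∞` the supremum of
`‖(φ(x₁), …, φ(x_m))‖_p` over the functionals `φ` in the closed unit ball of the dual `E'`;
for `p = ∞` it is `sup ‖x_j‖`. -/
def weakNorm (𝕜 : Type*) [RCLike 𝕜] {E : Type*} [NormedAddCommGroup E] [NormedSpace 𝕜 E]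
    (p : ℝ≥0∞) {m : ℕ} (x : Fin m → E) : ℝ :=
  if p = ∞ then strongNorm ∞ x
  else ⨆ φ : Metric.closedBall (0 : StrongDual 𝕜 E) 1,
    strongNorm p (fun j => (φ : StrongDual 𝕜 E) (x j))

/-- The supremum in `weakNorm` is that of a bounded set. -/
theorem bddAbove_weakNorm (𝕜 : Type*) [RCLike 𝕜] {E : Type*} [NormedAddCommGroup E]
    [NormedSpace 𝕜 E] (p : ℝ≥0∞) (hp : 1 ≤ p) {m : ℕ} (x : Fin m → E) :
    BddAbove (Set.range fun φ : Metric.closedBall (0 : StrongDual 𝕜 E) 1 =>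
      strongNorm p (fun j => (φ : StrongDual 𝕜 E) (x j))) := by
  have : Fact (1 ≤ p) := ⟨hp⟩
  refine ⟨∑ j, ‖x j‖, ?_⟩
  rintro _ ⟨φ, rfl⟩
  have h1 : (WithLp.toLp p (fun j => (φ : StrongDual 𝕜 E) (x j)) : PiLp p (fun _ : Fin m => 𝕜))
      = ∑ j, PiLp.single p j ((φ : StrongDual 𝕜 E) (x j)) := by
    ext i
    simp
  have hφ : ‖(φ : StrongDual 𝕜 E)‖ ≤ 1 := mem_closedBall_zero_iff.1 φ.2
  simp only [strongNorm]
  rw [h1]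
  refine (norm_sum_le _ _).trans (Finset.sum_le_sum fun j _ => ?_)
  rw [PiLp.norm_single]
  exact (φ : StrongDual 𝕜 E).le_of_opNorm_le hφ (x j) |>.trans (by simp)

/-- `T` is absolutely `(q; p₁, …, p_n)`-summing. -/
def IsAbsolutelySumming {𝕜 : Type*} [RCLike 𝕜] {n : ℕ} {E : Fin n → Type*}
    [∀ i, NormedAddCommGroup (E i)] [∀ i, NormedSpace 𝕜 (E i)]
    {F : Type*} [NormedAddCommGroup F] [NormedSpace 𝕜 F]
    (q : ℝ≥0∞) (p : Fin n → ℝ≥0∞) (T : ContinuousMultilinearMap 𝕜 E F) : Prop :=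
  ∃ C : ℝ, 0 ≤ C ∧ ∀ (m : ℕ) (x : (i : Fin n) → Fin m → E i),
    strongNorm q (fun j => T (fun i => x i j)) ≤ C * ∏ i, weakNorm 𝕜 (p i) (x i)

/-- The class `𝓛_{as,p}(E₁, …, E_n; F)` of the absolutely `p`-summing, that is, absolutely
`(p; p, …, p)`-summing, continuous `n`-linear maps. -/
def absolutelySummingMaps (𝕜 : Type*) [RCLike 𝕜] {n : ℕ} (E : Fin n → Type*)
    [∀ i, NormedAddCommGroup (E i)] [∀ i, NormedSpace 𝕜 (E i)]
    (F : Type*) [NormedAddCommGroup F] [NormedSpace 𝕜 F] (p : ℝ≥0∞) :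
    Set (ContinuousMultilinearMap 𝕜 E F) :=
  {T | IsAbsolutelySumming p (fun _ => p) T}

/-- `E` is an `𝓛_{∞,c}`-space: every finite-dimensional subspace `G` lies in a finite-dimensional
subspace `H` that admits an isomorphism `v` onto `l_∞^{dim H}` with `‖v‖ ‖v⁻¹‖ < c`.
(`Fin k → 𝕜` carries the supremum norm.) -/
def IsScriptLInftySpaceWith (𝕜 : Type*) [RCLike 𝕜] (E : Type*) [NormedAddCommGroup E]
    [NormedSpace 𝕜 E] (c : ℝ) : Prop :=
  ∀ G : Submodule 𝕜 E, FiniteDimensional 𝕜 G →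
    ∃ H : Submodule 𝕜 E, G ≤ H ∧ FiniteDimensional 𝕜 H ∧
      ∃ v : H ≃L[𝕜] (Fin (Module.finrank 𝕜 H) → 𝕜),
        ‖(v : H →L[𝕜] (Fin (Module.finrank 𝕜 H) → 𝕜))‖ *
          ‖(v.symm : (Fin (Module.finrank 𝕜 H) → 𝕜) →L[𝕜] H)‖ < c

/-- `E` is an `𝓛_∞`-space: it is an `𝓛_{∞,c}`-space for some `c > 1`. -/
def IsScriptLInftySpace (𝕜 : Type*) [RCLike 𝕜] (E : Type*) [NormedAddCommGroup E]
    [NormedSpace 𝕜 E] : Prop :=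
  ∃ c : ℝ, 1 < c ∧ IsScriptLInftySpaceWith 𝕜 E c

end

/-! The case `r = p` is trivial and `r = ∞` is continuity. For `p < r < ∞` the estimate comes from
complex interpolation between boundedness of `T` and its `p`-summing estimate.

In an `𝓛_∞`-space a finite sequence factors through some `l_∞^k`, its coordinates being values of
functionals of norm at most one (`IsScriptLInftySpaceWith.exists_factorization`). Weak norms thereby
become coordinatewise `l_r` norms, and by `weakNorm_map_le` coordinatewise `l_p` bounds return to
weak norms in `E i`. The constants depend neither on `k` nor on `m`, so it suffices to treat a
multilinear map on spaces `l_∞^k`.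

There the moduli of the coordinates are raised to a complex power `w` and paired with a norming
sequence; the three lines theorem bounds the value at `w = 1` (`norm_sum_dual_le_of_endpoints`).
Real scalars are covered by complexifying, which costs only a factor `2 ^ n`. -/

/-- The isometric embedding of an `RCLike` field into `ℂ`. -/
noncomputable def rclikeToComplex (𝕜 : Type*) [RCLike 𝕜] : 𝕜 →+* ℂ where
  toFun z := ⟨RCLike.re z, RCLike.im z⟩
  map_one' := by apply Complex.ext <;> simp
  map_mul' x y := by apply Complex.ext <;> simp [RCLike.mul_re, RCLike.mul_im]
  map_zero' := by apply Complex.ext <;> simp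
  map_add' x y := by apply Complex.ext <;> simp

theorem norm_rclikeToComplex {𝕜 : Type*} [RCLike 𝕜] (z : 𝕜) : ‖rclikeToComplex 𝕜 z‖ = ‖z‖ := by
  rw [← sq_eq_sq₀ (norm_nonneg _) (norm_nonneg _), RCLike.norm_sq_eq_def (z := z), Complex.sq_norm,
    Complex.normSq_apply]
  rfl

theorem rclikeToComplex_ofReal {𝕜 : Type*} [RCLike 𝕜] (x : ℝ) :
    rclikeToComplex 𝕜 (x : 𝕜) = (x : ℂ) := by
  apply Complex.ext <;> simp [rclikeToComplex]

/-- The power `a ^ w` of a nonnegative real number, with value `0` at `a = 0` for all `w`, so that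
it is an entire function of `w`. -/
noncomputable def entirePow (a : ℝ) (w : ℂ) : ℂ := if a = 0 then 0 else Complex.exp (w * (Real.log a : ℝ))

theorem differentiable_entirePow (a : ℝ) : Differentiable ℂ (entirePow a) := by
  unfold entirePow
  split_ifs
  · exact differentiable_const _
  · fun_prop

theorem entirePow_ofReal {a s : ℝ} (ha : 0 ≤ a) (hs : 0 < s) :
    entirePow a (s : ℂ) = ((a ^ s : ℝ) : ℂ) := by
  unfold entirePow
  split_ifs with h
  · simp [h, Real.zero_rpow hs.ne']
  · rw [Real.rpow_def_of_pos (lt_of_le_of_ne ha (Ne.symm h))]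
    push_cast
    ring_nf

theorem norm_entirePow_le {a : ℝ} (ha : 0 ≤ a) (w : ℂ) : ‖entirePow a w‖ ≤ a ^ w.re := by
  unfold entirePow
  split_ifs with h
  · simpa using Real.rpow_nonneg ha _
  · rw [Complex.norm_exp, Real.rpow_def_of_pos (lt_of_le_of_ne ha (Ne.symm h))]
    simp [mul_comm]

/-! ### Complexification of multilinear forms -/

section Complexification

variable {𝕜 : Type*} [RCLike 𝕜] {n : ℕ} {k : Fin n → ℕ}

/-- The complex-multilinear extension of a multilinear form. -/
noncomputable def complexExtension (B : MultilinearMap 𝕜 (fun i => Fin (k i) → 𝕜) 𝕜)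
    (y : ∀ i, Fin (k i) → ℂ) : ℂ :=
  ∑ l : ∀ i, Fin (k i), rclikeToComplex 𝕜 (B fun i => Pi.single (l i) 1) * ∏ i, y i (l i)

theorem complexExtension_map (B : MultilinearMap 𝕜 (fun i => Fin (k i) → 𝕜) 𝕜)
    (y : ∀ i, Fin (k i) → 𝕜) :
    complexExtension B (fun i l => rclikeToComplex 𝕜 (y i l)) = rclikeToComplex 𝕜 (B y) := by
  have h : B y = ∑ l : ∀ i, Fin (k i), (∏ i, y i (l i)) * B fun i => Pi.single (l i) 1 := by
    conv_lhs =>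
      rw [show y = fun i => ∑ l, y i l • Pi.single l (1 : 𝕜) from
        funext fun i => pi_eq_sum_univ' (y i)]
    rw [MultilinearMap.map_sum]
    simp_rw [MultilinearMap.map_smul_univ, smul_eq_mul]
  rw [h, complexExtension, map_sum]
  simp_rw [map_mul, map_prod, mul_comm]

/-- Splitting each `c i l` into real and imaginary parts and expanding the product gives one term
for each set `S` of slots that take the real part. Each term is, up to a power of `I`, a value of
`B` itself, so estimates over `𝕜` suffice. -/
theorem norm_complexExtension_le (B : MultilinearMap 𝕜 (fun i => Fin (k i) → 𝕜) 𝕜)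
    (s : ∀ i, Fin (k i) → 𝕜) (c : ∀ i, Fin (k i) → ℂ) :
    ‖complexExtension B (fun i l => rclikeToComplex 𝕜 (s i l) * c i l)‖ ≤
      ∑ S : Finset (Fin n), ‖B fun i l =>
        s i l * ((if i ∈ S then (c i l).re else (c i l).im : ℝ) : 𝕜)‖ := by
  set u : Finset (Fin n) → ∀ i, Fin (k i) → 𝕜 := fun S i l =>
    s i l * ((if i ∈ S then (c i l).re else (c i l).im : ℝ) : 𝕜) with hu
  have h : complexExtension B (fun i l => rclikeToComplex 𝕜 (s i l) * c i l) =
      ∑ S : Finset (Fin n), Complex.I ^ (Finset.univ \ S).card * rclikeToComplex 𝕜 (B (u S)) := by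
    simp_rw [← complexExtension_map, complexExtension, Finset.mul_sum]
    rw [Finset.sum_comm]
    refine Finset.sum_congr rfl fun l _ => ?_
    have h1 : ∀ i, rclikeToComplex 𝕜 (s i (l i)) * c i (l i) =
        rclikeToComplex 𝕜 (s i (l i)) * ((c i (l i)).re : ℂ) +
          Complex.I * (rclikeToComplex 𝕜 (s i (l i)) * ((c i (l i)).im : ℂ)) := fun i => by
      conv_lhs => rw [← Complex.re_add_im (c i (l i))]
      ring
    simp_rw [h1]
    rw [Finset.prod_add, Finset.mul_sum, Finset.powerset_univ]
    refine Finset.sum_congr rfl fun S _ => ?_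
    rw [Finset.prod_mul_distrib (f := fun _ => Complex.I), Finset.prod_const,
      ← Finset.prod_sdiff (Finset.subset_univ S)]
    have h2 : ∏ i ∈ S, rclikeToComplex 𝕜 (u S i (l i)) =
        ∏ i ∈ S, rclikeToComplex 𝕜 (s i (l i)) * ((c i (l i)).re : ℂ) :=
      Finset.prod_congr rfl fun i hi => by
        simp [hu, hi, rclikeToComplex_ofReal]
    have h3 : ∏ i ∈ Finset.univ \ S, rclikeToComplex 𝕜 (u S i (l i)) =
        ∏ i ∈ Finset.univ \ S, rclikeToComplex 𝕜 (s i (l i)) * ((c i (l i)).im : ℂ) :=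
      Finset.prod_congr rfl fun i hi => by
        have hi : i ∉ S := by simpa using hi
        simp [hu, hi, rclikeToComplex_ofReal]
    rw [h2, h3]
    ring
  rw [h]
  refine (norm_sum_le _ _).trans_eq (Finset.sum_congr rfl fun S _ => ?_)
  simp [norm_rclikeToComplex, hu]

end Complexification

/-! ### Interpolation on products of finite-dimensional sup-norm spaces -/

section Interpolation

variable {𝕜 : Type*} [RCLike 𝕜] {n m : ℕ} {k : Fin n → ℕ}
  {F : Type*} [NormedAddCommGroup F] [NormedSpace 𝕜 F]

/-- Three lines estimate for multilinear maps on `l_∞^k`, tested against a norming sequence. -/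
theorem norm_sum_dual_le_of_endpoints {p r : ℝ} (hp : 1 ≤ p) (hpr : p < r)
    (B : MultilinearMap 𝕜 (fun i => Fin (k i) → 𝕜) F)
    (h0 : ∀ y : ∀ i, Fin (k i) → 𝕜, (∀ i l, ‖y i l‖ ≤ 1) → ‖B y‖ ≤ 1)
    (h1 : ∀ y : ∀ i, Fin m → Fin (k i) → 𝕜, (∀ i l, ∑ j, ‖y i j l‖ ^ p ≤ 1) →
      ∑ j, ‖B fun i => y i j‖ ^ p ≤ 1)
    (x : ∀ i, Fin m → Fin (k i) → 𝕜) (hx : ∀ i l, ∑ j, ‖x i j l‖ ^ r ≤ 1)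
    (μ : Fin m → ℝ) (hμ : ∀ j, 0 ≤ μ j) (hμr : ∑ j, μ j ^ r ≤ 1)
    (φ : Fin m → StrongDual 𝕜 F) (hφ : ∀ j, ‖φ j‖ ≤ 1) :
    ‖∑ j, ((μ j ^ (r - 1) : ℝ) : ℂ) * rclikeToComplex 𝕜 (φ j (B fun i => x i j))‖ ≤ 2 ^ n := by
  have hp0 : 0 < p := by linarith
  have hr0 : 0 < r := by linarith
  have le_one : ∀ a : Fin m → ℝ, (∀ j, 0 ≤ a j) → ∑ j, a j ^ r ≤ 1 → ∀ j, a j ≤ 1 := by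
    intro a ha h j
    have := (Finset.single_le_sum (f := fun j => a j ^ r)
      (fun j _ => Real.rpow_nonneg (ha j) _) (Finset.mem_univ j)).trans h
    by_contra! hlt
    exact absurd this (not_le.2 (Real.one_lt_rpow hlt hr0))
  have hμ1 := le_one μ hμ hμr
  have hx1 : ∀ i j l, ‖x i j l‖ ≤ 1 := fun i j l =>
    le_one (fun j => ‖x i j l‖) (fun _ => norm_nonneg _) (hx i l) j
  -- Polar decomposition: only the moduli will be raised to complex powers; the phases `s` stay
  -- fixed.
  choose s hs hsx using fun i j l => RCLike.exists_norm_mul_eq_self (x i j l)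
  -- On the line `re w = q`, `(|x| ^ q) ^ p = |x| ^ r`, which turns the `l_r` hypothesis into the
  -- `l_p` one. Since `1 < q ≤ r`, the point `1` lies in the strip and `r - w` keeps nonnegative
  -- real part there.
  set q : ℝ := r / p with hq
  have hq1 : 1 < q := (one_lt_div hp0).2 hpr
  have hqr : q ≤ r := div_le_self hr0.le hp
  let D : Fin m → MultilinearMap 𝕜 (fun i => Fin (k i) → 𝕜) 𝕜 := fun j =>
    (φ j : F →ₗ[𝕜] 𝕜).compMultilinearMap B
  have hD : ∀ j y, ‖D j y‖ ≤ ‖B y‖ := fun j y =>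
    ((φ j).le_of_opNorm_le (hφ j) _).trans_eq (one_mul _)
  let f : ℂ → ℂ := fun w => ∑ j, entirePow (μ j) (r - w) *
    complexExtension (D j) (fun i l => rclikeToComplex 𝕜 (s i j l) * entirePow ‖x i j l‖ w)
  have hf1 : f 1 = ∑ j, ((μ j ^ (r - 1) : ℝ) : ℂ) * rclikeToComplex 𝕜 (φ j (B fun i => x i j)) := by
    refine Finset.sum_congr rfl fun j _ => ?_
    congr 1
    · rw [← entirePow_ofReal (hμ j) (by linarith)]
      push_cast
      rfl
    · refine Eq.trans ?_ (complexExtension_map (D j) fun i => x i j)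
      congr 1
      funext i l
      have := entirePow_ofReal (norm_nonneg (x i j l)) one_pos
      rw [Complex.ofReal_one] at this
      rw [this, Real.rpow_one, ← rclikeToComplex_ofReal (𝕜 := 𝕜), ← map_mul, hsx]
  have hfd : Differentiable ℂ f := by
    have h (a : ℝ) : Differentiable ℂ fun w : ℂ => entirePow a (r - w) :=
      (differentiable_entirePow a).comp (by fun_prop)
    have h' := differentiable_entirePow
    unfold f complexExtension
    fun_prop
  have hμw : ∀ j (w : ℂ), w.re ≤ q → ‖entirePow (μ j) (r - w)‖ ≤ 1 := fun j w hw =>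
    (norm_entirePow_le (hμ j) _).trans (Real.rpow_le_one (hμ j) (hμ1 j) (by simp; linarith))
  have hxw : ∀ i j l (w : ℂ), 0 ≤ w.re → ‖entirePow ‖x i j l‖ w‖ ≤ 1 := fun i j l w hw =>
    (norm_entirePow_le (norm_nonneg _) _).trans (Real.rpow_le_one (norm_nonneg _) (hx1 i j l) hw)
  let y : ℂ → Finset (Fin n) → ∀ i, Fin m → Fin (k i) → 𝕜 := fun w S i j l =>
    s i j l * ((if i ∈ S then (entirePow ‖x i j l‖ w).re else (entirePow ‖x i j l‖ w).im : ℝ) : 𝕜)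
  have hy : ∀ w S i j l, ‖y w S i j l‖ ≤ ‖x i j l‖ ^ w.re := by
    intro w S i j l
    refine le_trans ?_ (norm_entirePow_le (norm_nonneg _) _)
    simp only [y, norm_mul, hs, one_mul, RCLike.norm_ofReal]
    split_ifs
    · exact Complex.abs_re_le_norm _
    · exact Complex.abs_im_le_norm _
  have hfw : ∀ w, ‖f w‖ ≤ ∑ S : Finset (Fin n), ∑ j, μ j ^ (r - w.re) * ‖B fun i => y w S i j‖ := by
    intro w
    rw [Finset.sum_comm]
    refine (norm_sum_le _ _).trans (Finset.sum_le_sum fun j _ => ?_)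
    rw [norm_mul, ← Finset.mul_sum]
    refine mul_le_mul ?_ ?_ (norm_nonneg _) (Real.rpow_nonneg (hμ j) _)
    · simpa using norm_entirePow_le (hμ j) (r - w)
    · refine (norm_complexExtension_le _ _ _).trans (Finset.sum_le_sum fun S _ => hD j _)
  have hcard : ∑ _S : Finset (Fin n), (1 : ℝ) = 2 ^ n := by simp
  have key : ‖f 1‖ ≤ (2 : ℝ) ^ n := by
    have hmem : (1 : ℂ) ∈ Complex.HadamardThreeLines.verticalClosedStrip 0 q := by
      simp [Complex.HadamardThreeLines.verticalClosedStrip, hq1.le]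
    have := Complex.HadamardThreeLines.norm_le_interp_of_mem_verticalClosedStrip'
      (f := f) (a := 2 ^ n) (b := 2 ^ n) (by linarith : (0 : ℝ) < q) hmem hfd.diffContOnCl ?_ ?_ ?_
    · rwa [← Real.rpow_add (by positivity), sub_add_cancel, Real.rpow_one] at this
    · refine ⟨∑ j, ∑ l : ∀ i, Fin (k i), ‖D j fun i => Pi.single (l i) 1‖, ?_⟩
      rintro _ ⟨w, hw, rfl⟩
      obtain ⟨hw0, hwq⟩ : 0 ≤ w.re ∧ w.re ≤ q := hw
      refine (norm_sum_le _ _).trans (Finset.sum_le_sum fun j _ => ?_)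
      rw [norm_mul]
      refine (mul_le_of_le_one_left (norm_nonneg _) (hμw j w hwq)).trans ?_
      refine (norm_sum_le _ _).trans (Finset.sum_le_sum fun l _ => ?_)
      rw [norm_mul, norm_rclikeToComplex, norm_prod]
      refine mul_le_of_le_one_right (norm_nonneg _)
        (Finset.prod_le_one (fun _ _ => norm_nonneg _) fun i _ => ?_)
      rw [norm_mul, norm_rclikeToComplex, hs, one_mul]
      exact hxw i j _ w hw0
    -- On this edge all arguments have modulus at most one, so `h0` applies and the weights sum to
    -- at most one.
    · intro w (hw : w.re = 0)
      refine (hfw w).trans (le_of_le_of_eq (Finset.sum_le_sum fun S _ => ?_) hcard)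
      refine le_trans (Finset.sum_le_sum fun j _ => ?_) hμr
      rw [hw, sub_zero]
      refine mul_le_of_le_one_right (Real.rpow_nonneg (hμ j) _) (h0 _ fun i l => ?_)
      simpa [hw] using hy w S i j l
    · intro w (hw : w.re = q)
      refine (hfw w).trans (le_of_le_of_eq (Finset.sum_le_sum fun S _ => ?_) hcard)
      have hB := h1 (y w S) fun i l => by
        refine le_trans (Finset.sum_le_sum fun j _ => ?_) (hx i l)
        refine (Real.rpow_le_rpow (norm_nonneg _) (hy w S i j l) hp0.le).trans_eq ?_
        rw [hw, ← Real.rpow_mul (norm_nonneg _), hq, div_mul_cancel₀ _ hp0.ne']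
      have hpi : p⁻¹ ≤ 1 := inv_le_one_of_one_le₀ hp
      have hpi0 : 0 ≤ p⁻¹ := inv_nonneg.2 hp0.le
      -- Young's inequality with weights `1 - 1/p` and `1/p`; the exponent matches because `r * (1 -
      -- 1/p) = r - q`.
      have young : ∀ j, μ j ^ (r - w.re) * ‖B fun i => y w S i j‖ ≤
          (1 - p⁻¹) * μ j ^ r + p⁻¹ * ‖B fun i => y w S i j‖ ^ p := fun j => by
        refine le_of_eq_of_le ?_ (Real.geom_mean_le_arith_mean2_weighted (sub_nonneg.2 hpi) hpi0
          (Real.rpow_nonneg (hμ j) r) (Real.rpow_nonneg (norm_nonneg (B fun i => y w S i j)) p)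
          (sub_add_cancel _ _))
        rw [← Real.rpow_mul (hμ j), ← Real.rpow_mul (norm_nonneg _), mul_inv_cancel₀ hp0.ne',
          Real.rpow_one, hw, hq]
        ring_nf
      refine (Finset.sum_le_sum fun j _ => young j).trans ?_
      rw [Finset.sum_add_distrib, ← Finset.mul_sum, ← Finset.mul_sum]
      nlinarith
  rwa [hf1] at key

/-- Interpolation of multilinear maps on `l_∞^k` between the `p`-summing and the bounded
estimate. -/
theorem sum_rpow_le_of_endpoints {p r : ℝ} (hp : 1 ≤ p) (hpr : p < r)
    (B : MultilinearMap 𝕜 (fun i => Fin (k i) → 𝕜) F)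
    (h0 : ∀ y : ∀ i, Fin (k i) → 𝕜, (∀ i l, ‖y i l‖ ≤ 1) → ‖B y‖ ≤ 1)
    (h1 : ∀ y : ∀ i, Fin m → Fin (k i) → 𝕜, (∀ i l, ∑ j, ‖y i j l‖ ^ p ≤ 1) →
      ∑ j, ‖B fun i => y i j‖ ^ p ≤ 1)
    (x : ∀ i, Fin m → Fin (k i) → 𝕜) (hx : ∀ i l, ∑ j, ‖x i j l‖ ^ r ≤ 1) :
    (∑ j, ‖B fun i => x i j‖ ^ r) ^ (1 / r) ≤ 2 ^ n := by
  have hr0 : 0 < r := by linarith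
  set N : Fin m → ℝ := fun j => ‖B fun i => x i j‖ with hN
  have hN0 : ∀ j, 0 ≤ N j := fun j => norm_nonneg _
  set S : ℝ := ∑ j, N j ^ r with hS
  have hS0 : 0 ≤ S := Finset.sum_nonneg fun j _ => Real.rpow_nonneg (hN0 j) _
  rcases hS0.eq_or_lt with h | hSpos
  · rw [← h, Real.zero_rpow (by positivity)]
    positivity
  set R : ℝ := S ^ (1 / r) with hR
  have hRpos : 0 < R := Real.rpow_pos_of_pos hSpos _
  have hRr : R ^ r = S := by
    rw [hR, ← Real.rpow_mul hS0, one_div_mul_cancel hr0.ne', Real.rpow_one]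
  choose φ hφ hφB using fun j => exists_dual_vector'' 𝕜 (B fun i => x i j)
  -- The extremal sequence in `l_r`–`l_{r'}` duality: with `μ j = N j / R` and norming functionals
  -- `φ j`, the tested sum equals `R` exactly.
  have key := norm_sum_dual_le_of_endpoints hp hpr B h0 h1 x hx (fun j => N j / R)
    (fun j => div_nonneg (hN0 j) hRpos.le) (by
      simp_rw [Real.div_rpow (hN0 _) hRpos.le, hRr]
      rw [← Finset.sum_div, ← hS, div_self hSpos.ne']) φ hφ
  simp_rw [hφB, rclikeToComplex_ofReal, ← Complex.ofReal_mul] at key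
  rw [← Complex.ofReal_sum, Complex.norm_real] at key
  refine le_trans (le_of_eq ?_) ((le_abs_self _).trans key)
  have : ∀ j, (N j / R) ^ (r - 1) * N j = N j ^ r * (R / S) := fun j => by
    rcases (hN0 j).eq_or_lt with h | h
    · rw [← h, Real.zero_rpow hr0.ne']; simp
    · rw [Real.div_rpow h.le hRpos.le, Real.rpow_sub_one h.ne', Real.rpow_sub_one hRpos.ne', hRr]
      field_simp
  change R = ∑ j, (N j / R) ^ (r - 1) * N j
  simp_rw [this]
  rw [← Finset.sum_mul, ← hS]
  field_simp

end Interpolation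

/-! ### Strong and weak norms, and factorization through `l_∞^k` -/

section WeakNorm

variable {𝕜 : Type*} [RCLike 𝕜] {E : Type*} [NormedAddCommGroup E] [NormedSpace 𝕜 E]

theorem strongNorm_eq_sum {p : ℝ≥0∞} (hp : 1 ≤ p) (hp' : p ≠ ∞) {m : ℕ} (a : Fin m → E) :
    strongNorm p a = (∑ j, ‖a j‖ ^ p.toReal) ^ (1 / p.toReal) :=
  PiLp.norm_eq_sum (ENNReal.toReal_pos (by positivity) hp') _

theorem strongNorm_nonneg {p : ℝ≥0∞} (hp : 1 ≤ p) {m : ℕ} (a : Fin m → E) :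
    0 ≤ strongNorm p a := by
  have : Fact (1 ≤ p) := ⟨hp⟩
  exact norm_nonneg _

theorem strongNorm_top {m : ℕ} (a : Fin m → E) : strongNorm ∞ a = ‖a‖ :=
  PiLp.norm_toLp a

theorem strongNorm_le_iff {p : ℝ≥0∞} (hp : 1 ≤ p) (hp' : p ≠ ∞) {m : ℕ} (a : Fin m → E) {C : ℝ}
    (hC : 0 ≤ C) : strongNorm p a ≤ C ↔ ∑ j, ‖a j‖ ^ p.toReal ≤ C ^ p.toReal := by
  have h0 : 0 < p.toReal := ENNReal.toReal_pos (by positivity) hp'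
  rw [strongNorm_eq_sum hp hp', one_div, Real.rpow_inv_le_iff_of_pos
    (Finset.sum_nonneg fun j _ => Real.rpow_nonneg (norm_nonneg _) _) hC h0]

theorem strongNorm_smul {p : ℝ≥0∞} (hp : 1 ≤ p) {m : ℕ} (c : 𝕜) (a : Fin m → E) :
    strongNorm p (fun j => c • a j) = ‖c‖ * strongNorm p a := by
  have : Fact (1 ≤ p) := ⟨hp⟩
  exact norm_smul c (WithLp.toLp p a)

theorem strongNorm_sum_le {p : ℝ≥0∞} (hp : 1 ≤ p) {m : ℕ} {ι : Type*} (t : Finset ι)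
    (a : ι → Fin m → E) :
    strongNorm p (fun j => ∑ l ∈ t, a l j) ≤ ∑ l ∈ t, strongNorm p (a l) := by
  have : Fact (1 ≤ p) := ⟨hp⟩
  have h : (WithLp.toLp p (fun j => ∑ l ∈ t, a l j) : PiLp p fun _ : Fin m => E) =
      ∑ l ∈ t, WithLp.toLp p (a l) := by
    ext j
    simp
  rw [strongNorm, h]
  exact norm_sum_le _ _

theorem norm_le_strongNorm {p : ℝ≥0∞} (hp : 1 ≤ p) {m : ℕ} (a : Fin m → E) (j : Fin m) :
    ‖a j‖ ≤ strongNorm p a := by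
  have : Fact (1 ≤ p) := ⟨hp⟩
  exact PiLp.norm_apply_le (WithLp.toLp p a) j

theorem strongNorm_dual_le_weakNorm {p : ℝ≥0∞} (hp : 1 ≤ p) (hp' : p ≠ ∞) {m : ℕ} (x : Fin m → E)
    (φ : StrongDual 𝕜 E) (hφ : ‖φ‖ ≤ 1) :
    strongNorm p (fun j => φ (x j)) ≤ weakNorm 𝕜 p x := by
  rw [weakNorm, if_neg hp']
  exact le_ciSup (bddAbove_weakNorm 𝕜 p hp x)
    (⟨φ, mem_closedBall_zero_iff.2 hφ⟩ : Metric.closedBall (0 : StrongDual 𝕜 E) 1)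

theorem norm_le_weakNorm {p : ℝ≥0∞} (hp : 1 ≤ p) (hp' : p ≠ ∞) {m : ℕ} (x : Fin m → E)
    (j : Fin m) : ‖x j‖ ≤ weakNorm 𝕜 p x := by
  obtain ⟨φ, hφ, hx⟩ := exists_dual_vector'' 𝕜 (x j)
  have h := (norm_le_strongNorm hp (fun j => φ (x j)) j).trans
    (strongNorm_dual_le_weakNorm hp hp' x φ hφ)
  simpa [hx] using h

theorem weakNorm_nonneg {p : ℝ≥0∞} (hp : 1 ≤ p) (hp' : p ≠ ∞) {m : ℕ} (x : Fin m → E) :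
    0 ≤ weakNorm 𝕜 p x :=
  (strongNorm_nonneg hp _).trans (strongNorm_dual_le_weakNorm hp hp' x 0 (by simp))

/-- The dual of `l_∞^k` is `l_1^k`: test `ψ` on the vector of unimodular phases of its coefficients.
-/
theorem sum_norm_apply_single_le {k : ℕ} (ψ : StrongDual 𝕜 (Fin k → 𝕜)) :
    ∑ l, ‖ψ (Pi.single l 1)‖ ≤ ‖ψ‖ := by
  choose c hc hψ using fun l => RCLike.exists_norm_eq_mul_self (ψ (Pi.single l 1))
  have h : ψ c = ((∑ l, ‖ψ (Pi.single l 1)‖ : ℝ) : 𝕜) := by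
    conv_lhs => rw [pi_eq_sum_univ' c]
    simp [hψ]
  have h' : ‖ψ c‖ ≤ ‖ψ‖ * 1 :=
    ψ.le_opNorm_of_le ((pi_norm_le_iff_of_nonneg zero_le_one).2 fun l => (hc l).le)
  rw [h, RCLike.norm_ofReal, mul_one] at h'
  exact (le_abs_self _).trans h'

/-- A functional of norm at most one pulls back along `u` to an `l_1` combination of coordinates
with total mass at most `‖u‖`; Minkowski's inequality finishes. -/
theorem weakNorm_map_le {p : ℝ≥0∞} (hp : 1 ≤ p) (hp' : p ≠ ∞) {k m : ℕ}
    (u : (Fin k → 𝕜) →L[𝕜] E) (y : Fin m → Fin k → 𝕜)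
    (hy : ∀ l, strongNorm p (fun j => y j l) ≤ 1) :
    weakNorm 𝕜 p (fun j => u (y j)) ≤ ‖u‖ := by
  rw [weakNorm, if_neg hp']
  have : Nonempty (Metric.closedBall (0 : StrongDual 𝕜 E) 1) := ⟨⟨0, by simp⟩⟩
  refine ciSup_le fun ⟨φ, hφ⟩ => ?_
  rw [mem_closedBall_zero_iff] at hφ
  set ψ : StrongDual 𝕜 (Fin k → 𝕜) := φ.comp u
  have h : (fun j => φ (u (y j))) = fun j => ∑ l, ψ (Pi.single l 1) • y j l := by
    funext j
    change ψ (y j) = _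
    conv_lhs => rw [pi_eq_sum_univ' (y j)]
    simp [mul_comm]
  change strongNorm p (fun j => φ (u (y j))) ≤ ‖u‖
  rw [h]
  refine (strongNorm_sum_le hp _ _).trans ?_
  simp_rw [strongNorm_smul hp]
  refine (Finset.sum_le_sum fun l _ => mul_le_of_le_one_right (norm_nonneg _) (hy l)).trans ?_
  refine (sum_norm_apply_single_le ψ).trans ((φ.opNorm_comp_le u).trans ?_)
  exact mul_le_of_le_one_left (norm_nonneg _) hφ

/-- Finite sequences in an `𝓛_∞`-space factor through some `l_∞^k` with uniform constants. -/
theorem IsScriptLInftySpaceWith.exists_factorization {c : ℝ}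
    (hE : IsScriptLInftySpaceWith 𝕜 E c) {m : ℕ} (x : Fin m → E) :
    ∃ (k : ℕ) (u : (Fin k → 𝕜) →L[𝕜] E) (ξ : Fin m → Fin k → 𝕜), ‖u‖ ≤ c ∧
      (∀ j, u (ξ j) = x j) ∧
      ∀ l, ∃ φ : StrongDual 𝕜 E, ‖φ‖ ≤ 1 ∧ ∀ j, φ (x j) = ξ j l := by
  obtain ⟨H, hGH, -, v, hv⟩ := hE (Submodule.span 𝕜 (Set.range x))
    (FiniteDimensional.span_of_finite 𝕜 (Set.finite_range x))
  have hxH : ∀ j, x j ∈ H := fun j => hGH (Submodule.subset_span ⟨j, rfl⟩)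
  set V : H →L[𝕜] (Fin (Module.finrank 𝕜 H) → 𝕜) := v.toContinuousLinearMap
  set W : (Fin (Module.finrank 𝕜 H) → 𝕜) →L[𝕜] H := v.symm.toContinuousLinearMap
  have hWV : ∀ z, W (V z) = z := v.symm_apply_apply
  -- Scaling by `‖V‖` makes the coordinate functionals contractive on `H`, ready for Hahn–Banach,
  -- and moves the whole distortion `‖V‖ * ‖W‖ < c` into `u`.
  refine ⟨Module.finrank 𝕜 H, (‖V‖ : 𝕜) • H.subtypeL.comp W, fun j => (‖V‖ : 𝕜)⁻¹ • V ⟨x j, hxH j⟩, ?_, ?_, ?_⟩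
  · rw [norm_smul, RCLike.norm_ofReal, abs_norm]
    refine (mul_le_mul_of_nonneg_left ?_ (norm_nonneg _)).trans hv.le
    refine ContinuousLinearMap.opNorm_le_bound _ (norm_nonneg _) fun z => W.le_opNorm z
  · intro j
    rcases eq_or_ne V 0 with h | h
    · have : (⟨x j, hxH j⟩ : H) = 0 := by rw [← hWV ⟨x j, hxH j⟩, h]; simp
      have : x j = 0 := congrArg Subtype.val this
      simp [h, this]
    · have h' : (‖V‖ : 𝕜) ≠ 0 := by simpa using h
      simp [hWV, smul_smul, h']
  · intro l
    set π : StrongDual 𝕜 H := (‖V‖ : 𝕜)⁻¹ • (ContinuousLinearMap.proj l).comp V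
    obtain ⟨φ, hφ, hφn⟩ := exists_extension_norm_eq H π
    refine ⟨φ, ?_, fun j => hφ ⟨x j, hxH j⟩⟩
    rw [hφn]
    refine ContinuousLinearMap.opNorm_le_bound _ zero_le_one fun z => ?_
    have h1 : ‖V z l‖ ≤ ‖V‖ * ‖z‖ := (norm_le_pi_norm _ l).trans (V.le_opNorm z)
    have h2 : ‖π z‖ = ‖V‖⁻¹ * ‖V z l‖ := by simp [π]
    rw [h2]
    refine (mul_le_mul_of_nonneg_left h1 (inv_nonneg.2 (norm_nonneg _))).trans ?_
    rw [← mul_assoc]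
    exact mul_le_mul_of_nonneg_right inv_mul_le_one (norm_nonneg _)

end WeakNorm

/-! ### The inclusion theorem -/

theorem isAbsolutelySumming_top {𝕜 : Type*} [RCLike 𝕜] {n : ℕ} {E : Fin n → Type*}
    [∀ i, NormedAddCommGroup (E i)] [∀ i, NormedSpace 𝕜 (E i)]
    {F : Type*} [NormedAddCommGroup F] [NormedSpace 𝕜 F] (T : ContinuousMultilinearMap 𝕜 E F) :
    IsAbsolutelySumming ∞ (fun _ => ∞) T := by
  refine ⟨‖T‖, norm_nonneg _, fun m x => ?_⟩
  simp only [weakNorm, if_true, strongNorm_top]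
  refine (pi_norm_le_iff_of_nonneg (by positivity)).2 fun j => (T.le_opNorm _).trans ?_
  gcongr with i
  exact norm_le_pi_norm (x i) j

theorem theorem3p9 {𝕜 : Type*} [RCLike 𝕜] {n : ℕ} (E : Fin n → Type*)
    [∀ i, NormedAddCommGroup (E i)] [∀ i, NormedSpace 𝕜 (E i)] [∀ i, CompleteSpace (E i)]
    (F : Type*) [NormedAddCommGroup F] [NormedSpace 𝕜 F] [CompleteSpace F]
    (hE : ∀ i, IsScriptLInftySpace 𝕜 (E i))
    (p r : ℝ≥0∞) (hp : 1 ≤ p) (hpr : p ≤ r) :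
    absolutelySummingMaps 𝕜 E F p ⊆ absolutelySummingMaps 𝕜 E F r := by
  rintro T ⟨C, hC, hT⟩
  rcases hpr.eq_or_lt with rfl | hlt
  · exact ⟨C, hC, hT⟩
  rcases eq_or_ne r ∞ with rfl | hr'
  · exact isAbsolutelySumming_top T
  have hp' : p ≠ ∞ := hlt.ne_top
  have hr : 1 ≤ r := hp.trans hpr
  have hp1 : 1 ≤ p.toReal := by simpa using ENNReal.toReal_mono hp' hp
  have hlt' : p.toReal < r.toReal := (ENNReal.toReal_lt_toReal hp' hr').2 hlt
  choose c hc1 hc using hE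
  -- One constant normalizing both endpoints: `‖T‖` serves the bounded estimate and `C` the
  -- `p`-summing one. The `+ 1` makes it invertible.
  set K : ℝ := max C ‖T‖ * ∏ i, c i + 1 with hK
  have hc0 : 0 ≤ ∏ i, c i := Finset.prod_nonneg fun i _ => by linarith [hc1 i]
  have hK0 : 0 < K := by positivity
  refine ⟨2 ^ n * K, by positivity, fun m x => ?_⟩
  set w : Fin n → ℝ := fun i => weakNorm 𝕜 r (x i) with hw
  have hw0 : ∀ i, 0 ≤ w i := fun i => weakNorm_nonneg hr hr' _
  have hrhs : 0 ≤ 2 ^ n * K * ∏ i, w i :=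
    mul_nonneg (by positivity) (Finset.prod_nonneg fun i _ => hw0 i)
  -- A vanishing weak norm forces its sequence to be zero; otherwise each sequence can be divided by
  -- its weak norm.
  by_cases hz : ∃ i, w i = 0
  · obtain ⟨i, hi⟩ := hz
    have hT0 : ∀ j, T (fun i => x i j) = 0 := fun j => T.map_coord_zero i
      (norm_le_zero_iff.1 ((norm_le_weakNorm (𝕜 := 𝕜) hr hr' (x i) j).trans_eq hi))
    rw [strongNorm_le_iff hr hr' _ hrhs]
    simp only [hT0, norm_zero, Real.zero_rpow (by linarith : r.toReal ≠ 0), Finset.sum_const_zero]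
    exact Real.rpow_nonneg hrhs _
  push Not at hz
  have hwpos : ∀ i, 0 < w i := fun i => lt_of_le_of_ne (hw0 i) (hz i).symm
  have hwprod : 0 < ∏ i, w i := Finset.prod_pos fun i _ => hwpos i
  choose k u ξ hu hux hξ using fun i => (hc i).exists_factorization (x i)
  let B : MultilinearMap 𝕜 (fun i => Fin (k i) → 𝕜) F :=
    ((K : 𝕜)⁻¹) • T.toMultilinearMap.compLinearMap fun i => (u i : (Fin (k i) → 𝕜) →ₗ[𝕜] E i)
  have hB : ∀ y, B y = (K : 𝕜)⁻¹ • T fun i => u i (y i) := fun y => rfl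
  have hKn : ‖(K : 𝕜)⁻¹‖ = K⁻¹ := by rw [norm_inv, RCLike.norm_ofReal, abs_of_pos hK0]
  have hKle : ∀ {D : ℝ} {a : Fin n → ℝ}, D ≤ max C ‖T‖ → (∀ i, 0 ≤ a i) → (∀ i, a i ≤ c i) →
      D * ∏ i, a i ≤ K := by
    intro D a hD ha hac
    have h1 : ∏ i, a i ≤ ∏ i, c i := Finset.prod_le_prod (fun i _ => ha i) fun i _ => hac i
    have h2 : D * ∏ i, a i ≤ max C ‖T‖ * ∏ i, c i :=
      mul_le_mul hD h1 (Finset.prod_nonneg fun i _ => ha i) (le_max_of_le_left hC)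
    linarith
  have key := sum_rpow_le_of_endpoints (m := m) hp1 hlt' B ?_ ?_
    (fun i j => ((w i : 𝕜)⁻¹) • ξ i j) ?_
  · have h1 : ∀ j, B (fun i => (w i : 𝕜)⁻¹ • ξ i j) =
        ((K : 𝕜)⁻¹ * ∏ i, (w i : 𝕜)⁻¹) • T fun i => x i j := fun j => by
      rw [B.map_smul_univ, hB, smul_smul, mul_comm]
      simp_rw [hux]
    simp_rw [h1] at key
    rw [← strongNorm_eq_sum hr hr', strongNorm_smul hr, norm_mul, norm_prod, hKn] at key
    have h2 : ∏ i, ‖(w i : 𝕜)⁻¹‖ = (∏ i, w i)⁻¹ := by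
      rw [← Finset.prod_inv_distrib]
      exact Finset.prod_congr rfl fun i _ => by
        rw [norm_inv, RCLike.norm_ofReal, abs_of_pos (hwpos i)]
    rw [h2, ← mul_inv, inv_mul_le_iff₀ (mul_pos hK0 hwprod)] at key
    exact key.trans_eq (by ring)
  · intro y hy
    rw [hB, norm_smul, hKn, inv_mul_le_iff₀ hK0, mul_one]
    refine (T.le_opNorm _).trans (hKle (le_max_right _ _) (fun i => norm_nonneg _) fun i => ?_)
    refine ((u i).le_opNorm_of_le ((pi_norm_le_iff_of_nonneg zero_le_one).2 (hy i))).trans ?_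
    rw [mul_one]
    exact hu i
  · intro y hy
    have h := strongNorm_le_iff hp hp' (fun j => B fun i => y i j) zero_le_one
    rw [Real.one_rpow] at h
    rw [← h]
    simp_rw [hB]
    rw [strongNorm_smul hp, hKn, inv_mul_le_iff₀ hK0, mul_one]
    refine (hT m fun i j => u i (y i j)).trans
      (hKle (le_max_left _ _) (fun i => weakNorm_nonneg hp hp' _) fun i => ?_)
    refine (weakNorm_map_le hp hp' (u i) (y i) fun l => ?_).trans (hu i)
    rw [strongNorm_le_iff hp hp' _ zero_le_one, Real.one_rpow]
    exact hy i l
  · intro i l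
    obtain ⟨φ, hφ, hφx⟩ := hξ i l
    have h := strongNorm_le_iff hr hr' (fun j => (w i : 𝕜)⁻¹ • ξ i j l) zero_le_one
    rw [Real.one_rpow] at h
    refine h.1 ?_
    rw [strongNorm_smul hr, norm_inv, RCLike.norm_ofReal, abs_of_pos (hwpos i),
      inv_mul_le_iff₀ (hwpos i), mul_one]
    simp_rw [← hφx]
    exact strongNorm_dual_le_weakNorm hr hr' (x i) φ hφ
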